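/- Let $G=(V,E)$ be a finite acyclic directed network, $s\in V$ a source, and $D\subseteq V$ a set of terminals such that no $d\in D$ has outgoing edges and every $d\in D$ is reachable from $s$ by a directed path. Every vertex $v\in V$ generates an unlimited sequence of uniform random bits, all bits at all vertices being mutually independent. A network code assigns to every edge $e=(u,v)$ a finite alphabet $\mathcal X_e$ and an encoding function which computes the edge message $X_e\in\mathcal X_e$ from the information $X_{\mathrm{In}(u)}$ available at $u$, that is, the messages on the edges entering $u$ together with the bits generated at $u$. Say that secure multicast has rate $R$ if there are a network code and a finite collection $K$ of the bits generated at $s$ that, up to relabelling, is a uniform random variable on $\{1,\dots,\lceil 2^{R}\rceil\}$, such that - (decoding) for every $d\in D$ there is a function $g_d$ with $g_d(X_{\mathrm{In}(d)})=K$ almost surely, i.e. $H(K\mid X_{\mathrm{In}(d)})=0$; - (secrecy) $I\bigl(K;(X_e: e \text{ enters } v)\bigr)=0$ for every $v\in V\setminus(D\cup\{s\})$. For $d\in D$, a vertex $u\notin\{s,d\}$ is a cut vertex for $(s,d)$ if every directed path from $s$ to $d$ goes through $u$. Such a $u$ is protected if, for some $\ell\ge 1$, there are vertices $x_1,\dots,x_\ell$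 and $y_1,\dots,y_\ell$ with $(y_k,u)\in E$ for all $k\in\{1,\dots,\ell\}$, and (possibly empty, not necessarily disjoint) directed paths in $G$, none containing $u$, from $s$ to $y_1$, from $x_k$ to $y_k$ for $1\le k\le \ell$, from $x_k$ to $y_{k+1}$ for $1\le k<\ell$, and from $x_\ell$ to $d$. Then secure multicast from $s$ to $D$ has some rate $R>0$ if and only if, for every $d\in D$, every cut vertex $u$ for $(s,d)$ is protected. -/

import Mathlib

open MeasureTheory ProbabilityTheory
open scoped ENNReal

noncomputable section

/-- An acyclic directed network on the vertex set `V`. -/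
structure AcyclicNetwork (V : Type*) extends Digraph V where
  acyclic : ∀ v, ¬ Relation.TransGen Adj v v

namespace AcyclicNetwork

variable {V : Type*} (G : AcyclicNetwork V)

/-! ### Paths, cut vertices and protected cut vertices -/

/-- There is a (possibly empty) directed path from `a` to `b`. -/
def Reachable (a b : V) : Prop := Relation.ReflTransGen G.Adj a b

/-- There is a (possibly empty) directed path from `a` to `b` none of whose vertices is `u`. -/
def ReachableAvoiding (u a b : V) : Prop :=
  a ≠ u ∧ Relation.ReflTransGen (fun p q => G.Adj p q ∧ q ≠ u) a b

/-- `u`, different from `s` and `d`, is a cut vertex for the pair `(s, d)`: every directed path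
from `s` to `d` goes through `u`. -/
def IsCutVertex (s d u : V) : Prop :=
  u ≠ s ∧ u ≠ d ∧ ¬ G.ReachableAvoiding u s d

/-- There is an alternating path from `s` to `d` that does not include `u` and all of whose
colliders are in-nodes of `u`.  The alternating path has intermediate vertices
`x 1, …, x ℓ` and colliders `y 1, …, y ℓ` (`ℓ ≥ 1`), and consists of directed paths
`s ⇝ y 1`, `x k ⇝ y k` (`1 ≤ k ≤ ℓ`), `x k ⇝ y (k + 1)` (`1 ≤ k < ℓ`) and `x ℓ ⇝ d`, which
may be empty and need not be disjoint. -/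
def IsProtected (s d u : V) : Prop :=
  ∃ (l : ℕ) (x y : ℕ → V), 1 ≤ l ∧
    G.ReachableAvoiding u s (y 1) ∧
    (∀ k, 1 ≤ k → k ≤ l → G.ReachableAvoiding u (x k) (y k)) ∧
    (∀ k, 1 ≤ k → k < l → G.ReachableAvoiding u (x k) (y (k + 1))) ∧
    G.ReachableAvoiding u (x l) d ∧
    (∀ k, 1 ≤ k → k ≤ l → G.Adj (y k) u)

/-! ### Network codes -/

/-- The edges of the network, as pairs (tail, head). -/
def Edge : Type _ := {e : V × V // G.Adj e.1 e.2}

/-- The tail `a` of the edge `(a, b)`. -/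
def tail (e : G.Edge) : V := e.1.1

/-- The head `b` of the edge `(a, b)`. -/
def head (e : G.Edge) : V := e.1.2

/-- The edges entering `v`. -/
def inEdges (v : V) : Set G.Edge := {e | G.head e = v}

/-- `e'` immediately precedes `e`: the head of `e'` is the tail of `e`. -/
def Precedes (e' e : G.Edge) : Prop := e' ∈ G.inEdges (G.tail e)

theorem precedes_wf [Finite V] : WellFounded G.Precedes := by
  have : IsTrans V (Relation.TransGen G.Adj) := ⟨fun _ _ _ => Relation.TransGen.trans⟩
  have : Std.Irrefl (Relation.TransGen G.Adj) := ⟨G.acyclic⟩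
  have h : WellFounded (Relation.TransGen G.Adj) := Finite.wellFounded_of_trans_of_irrefl _
  refine Subrelation.wf (r := InvImage (Relation.TransGen G.Adj) G.tail) ?_ (InvImage.wf _ h)
  intro e' e he
  have he' : G.head e' = G.tail e := he
  change Relation.TransGen G.Adj (G.tail e') (G.tail e)
  rw [← he']
  exact Relation.TransGen.single e'.2

/-- The outcomes of the random bits: `ω v j` is the `j`-th bit generated at the vertex `v`. -/
abbrev Outcome (V : Type*) : Type _ := V → ℕ → Bool

/-- The law of the random bits: all bits generated at all vertices are independent and uniform. -/
def bitsLaw (V : Type*) [Fintype V] : Measure (Outcome V) :=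
  Measure.pi fun _ : V => Measure.infinitePi fun _ : ℕ => (PMF.uniformOfFintype Bool).toMeasure

/-- A network code (without the decoders): a finite alphabet for every edge, and a local encoding
function for every edge, whose arguments are the messages on the edges entering the tail of the
edge and the bits generated at the tail. -/
structure NetworkCode where
  alphabet : G.Edge → Type
  fintypeAlphabet : ∀ e, Fintype (alphabet e)
  encode : ∀ e, ((∀ e' : G.inEdges (G.tail e), alphabet e'.1) × (ℕ → Bool)) → alphabet e
  measurable_encode : ∀ e,
    @Measurable _ (alphabet e)
      (@Prod.instMeasurableSpace _ _ (@MeasurableSpace.pi _ _ fun _ => ⊤) inferInstance) ⊤ (encode e)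

namespace NetworkCode

variable {G}
variable (C : G.NetworkCode)

instance (e : G.Edge) : Fintype (C.alphabet e) := C.fintypeAlphabet e

instance (e : G.Edge) : MeasurableSpace (C.alphabet e) := ⊤

instance (e : G.Edge) : DiscreteMeasurableSpace (C.alphabet e) := ⟨fun _ => trivial⟩

/-- The message `X_e` sent over the edge `e`, by recursion along the acyclic network: the
encoding function of `e` is applied to the information available at the tail of `e`. -/
def message [Finite V] (ω : Outcome V) : ∀ e : G.Edge, C.alphabet e :=
  G.precedes_wf.fix fun e X => C.encode e (fun e' => X e'.1 e'.2, ω (G.tail e))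

theorem message_eq [Finite V] (ω : Outcome V) (e : G.Edge) :
    C.message ω e = C.encode e (fun e' => C.message ω e'.1, ω (G.tail e)) :=
  G.precedes_wf.fix_eq _ e

/-- The messages on the edges in `β`. -/
def messagesOn [Finite V] (β : Set G.Edge) (ω : Outcome V) : ∀ e : β, C.alphabet e.1 :=
  fun e => C.message ω e.1

/-- All information available at `v`: the messages on the edges entering `v` and the bits
generated at `v`. -/
def infoAt [Finite V] (v : V) (ω : Outcome V) :
    (∀ e : G.inEdges v, C.alphabet e.1) × (ℕ → Bool) :=
  (C.messagesOn (G.inEdges v) ω, ω v)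

end NetworkCode

/-- The mutual information `I(X; Y)` of two random variables: the Kullback-Leibler divergence of
their joint law from the product of their laws. -/
def mutualInfo {Ω A B : Type*} [MeasurableSpace Ω] [MeasurableSpace A] [MeasurableSpace B]
    (μ : Measure Ω) (X : Ω → A) (Y : Ω → B) : ℝ≥0∞ :=
  InformationTheory.klDiv (μ.map fun ω => (X ω, Y ω)) ((μ.map X).prod (μ.map Y))

/-- Secure multicast at rate `R` from the source `s` to the terminals `D`, with every vertex
generating random bits and with secrecy constraints `B`.

The message `K` is a finite collection `J` of the bits generated at `s`, identified through `φ`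
with an element of an alphabet of size `⌈2 ^ R⌉` (so `K` is uniform on this alphabet); each
terminal recovers `K` from the information available to it; and for each `β ∈ B` the messages on
the edges in `β` have zero mutual information with `K`. -/
def HasSecureMulticastRate [Fintype V] (s : V) (D : Set V) (B : Set (Set G.Edge)) (R : ℝ) :
    Prop :=
  ∃ (C : G.NetworkCode) (J : Finset ℕ) (φ : (J → Bool) ≃ Fin ⌈(2 : ℝ) ^ R⌉₊)
    (K : Outcome V → Fin ⌈(2 : ℝ) ^ R⌉₊),
    (∀ ω, K ω = φ fun j => ω s j) ∧
    (∀ d ∈ D, ∃ g : (∀ e : G.inEdges d, C.alphabet e.1) × (ℕ → Bool) → Fin ⌈(2 : ℝ) ^ R⌉₊,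
      Measurable g ∧ ∀ᵐ ω ∂(bitsLaw V), g (C.infoAt d ω) = K ω) ∧
    (∀ β ∈ B, mutualInfo (bitsLaw V) K (C.messagesOn β) = 0)

/-- The secrecy constraints: the edges entering any single vertex other than the source and the
terminals. -/
def nodeEavesdroppers (s : V) (D : Set V) : Set (Set G.Edge) :=
  {β | ∃ v, v ∉ D ∪ {s} ∧ β = G.inEdges v}

end AcyclicNetwork

end

/-!
The secret can be hidden from a vertex `u` and yet reach `d` exactly if `s` and `d` are linked by an
undirected walk that avoids the edges into `u` and stays among the ancestors of `d`; for cut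
vertices such walks amount to the alternating paths of `IsProtected`.

**Necessity.**  Let `S` be the set of vertices that are linked to `s` by alternating paths that
avoid the cut vertex `u` and have their colliders among the in-nodes of `u`
(`alternatingComponent`).  All ancestors of an in-node of `u` lie in `S`, or none does, so each
message into `u` is a function either of the bits of `S` or of the bits of the complement.  If `u`
is not protected, `S` does not influence `d` except through `u`; hence the information at `d` is a
function of the messages `M` into `u` that come from `S` and of the bits of `Sᶜ`.  The secret is
independent of `M`, and both are independent of the bits of `Sᶜ`; so the secret is independent of
the information at `d` (`indep_sup_of_indep`), and `d` cannot recover it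
(`not_decodable_of_not_isProtected`).

**Sufficiency.**  One secret bit suffices.  For each terminal `d`, send a uniformly random flow over
`ZMod 2` from `s` to `d`, of value the secret bit, along the edges from which `d` can be reached:
every vertex puts fresh random bits on all its out-edges but one, and the last one balances the flow
(`flowRule`).  By conservation, `d` receives the secret (`IsRandomFlow.sum_terminal`).  Adding a
fixed flow `z` of value one to the random flow is a symmetry of the random bits that flips the
secret, so `u` learns nothing if some `z` vanishes on the edges into `u`
(`IsRandomFlow.eq_add`, `indepFun_of_flip`).  Modulo two orientations do not matter: a directed path
that avoids `u` carries such a flow, and so does an alternating path (`exists_isUnitFlow`).  The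
symmetries for the different terminals act on disjoint sets of fresh bits and on the common secret,
and can be applied together, so that one code serves all terminals.
-/

noncomputable section

namespace AcyclicNetwork

/-! ### Directed paths avoiding a vertex -/

section Paths

variable {V : Type*} {G : AcyclicNetwork V}

theorem ReachableAvoiding.refl {u a : V} (h : a ≠ u) : G.ReachableAvoiding u a a :=
  ⟨h, .refl⟩

theorem ReachableAvoiding.reachable {u a b : V} (h : G.ReachableAvoiding u a b) :
    G.Reachable a b :=
  Relation.ReflTransGen.mono (fun _ _ h => h.1) _ _ h.2

/-- A path either avoids `u` or has a final segment that starts at `u`. -/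
theorem Reachable.avoiding_or {a b : V} (h : G.Reachable a b) (u : V) :
    G.ReachableAvoiding u a b ∨ G.Reachable u b := by
  induction h with
  | refl =>
    by_cases h : a = u
    · exact .inr (h ▸ .refl)
    · exact .inl (.refl h)
  | @tail b c _ hbc ih =>
    rcases ih with ih | ih
    · by_cases hc : c = u
      · exact .inr (hc ▸ .refl)
      · exact .inl ⟨ih.1, ih.2.tail ⟨hbc, hc⟩⟩
    · exact .inr (ih.tail hbc)

/-- By acyclicity, no path to an in-node of `u` visits `u`. -/
theorem Reachable.avoiding_of_adj {a y u : V} (h : G.Reachable a y) (hy : G.Adj y u) :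
    G.ReachableAvoiding u a y :=
  (h.avoiding_or u).resolve_right fun h' => G.acyclic u (Relation.TransGen.tail' h' hy)

end Paths

/-! ### Random bits and independence -/

section Bits

variable {V : Type*}

instance [Fintype V] : IsProbabilityMeasure (bitsLaw V) := by
  unfold bitsLaw; infer_instance

/-- The σ-algebra generated by the bits of the vertices in `S`. -/
@[reducible]
def bitsSigma (S : Set V) : MeasurableSpace (Outcome V) :=
  ⨆ v ∈ S, MeasurableSpace.comap (fun ω : Outcome V => ω v) inferInstance

theorem bitsSigma_le (S : Set V) : bitsSigma S ≤ MeasurableSpace.pi :=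
  iSup₂_le fun v _ => (measurable_pi_apply v).comap_le

theorem measurable_bitsSigma {S : Set V} {v : V} (hv : v ∈ S) :
    Measurable[bitsSigma S] fun ω : Outcome V => ω v := by
  rw [measurable_iff_comap_le]
  exact le_iSup₂_of_le v hv le_rfl

theorem indep_bitsSigma_compl [Fintype V] (S : Set V) :
    Indep (bitsSigma S) (bitsSigma Sᶜ) (bitsLaw V) := by
  have h : iIndepFun (fun (v : V) (ω : Outcome V) => ω v) (bitsLaw V) :=
    iIndepFun_pi (X := fun _ : V => id) fun _ => aemeasurable_id
  exact indep_iSup_of_disjoint (fun v => (measurable_pi_apply v).comap_le) h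
    disjoint_compl_right

theorem bitsLaw_bit [Fintype V] (s : V) (j : ℕ) (b : Bool) :
    bitsLaw V {ω | ω s j = b} = 2⁻¹ := by
  have h1 : MeasurePreserving (Function.eval s) (bitsLaw V)
      (Measure.infinitePi fun _ : ℕ => (PMF.uniformOfFintype Bool).toMeasure) :=
    measurePreserving_eval _ s
  have h2 := Measure.infinitePi_map_eval
    (fun _ : ℕ => (PMF.uniformOfFintype Bool).toMeasure) j
  have h3 : bitsLaw V {ω | ω s j = b} = (PMF.uniformOfFintype Bool).toMeasure {b} := by
    rw [← h2, ← h1.map_eq, Measure.map_map (by fun_prop) h1.measurable,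
      Measure.map_apply ((measurable_pi_apply j).comp h1.measurable) (by measurability)]
    rfl
  rw [h3, PMF.toMeasure_apply_singleton _ _ (by measurability)]
  simp

/-- Flipping a fixed set of bits does not change their law. -/
theorem measurePreserving_xor [Fintype V] (c : V → ℕ → Bool) :
    MeasurePreserving (fun (ω : Outcome V) v j => xor (ω v j) (c v j)) (bitsLaw V)
      (bitsLaw V) := by
  refine measurePreserving_pi _ _ (f := fun v (x : ℕ → Bool) j => xor (x j) (c v j))
    fun v => ⟨?_, ?_⟩
  · exact measurable_pi_lambda _ fun j =>
      (measurable_of_countable fun b => xor b (c v j)).comp (measurable_pi_apply j)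
  · rw [Measure.infinitePi_map_pi _ (f := fun j b => xor b (c v j))
      fun j => measurable_of_countable _]
    congr 1
    funext j
    refine Measure.ext_of_singleton fun b => ?_
    rw [Measure.map_apply (measurable_of_countable _) (measurableSet_singleton _)]
    have : (fun x => xor x (c v j)) ⁻¹' {b} = {xor b (c v j)} := by
      ext x
      cases x <;> cases b <;> cases c v j <;> simp
    rw [this, PMF.toMeasure_apply_singleton _ _ (by measurability),
      PMF.toMeasure_apply_singleton _ _ (by measurability)]
    simp

end Bits

section Independence

variable {Ω : Type*} [mΩ : MeasurableSpace Ω] {μ : Measure Ω}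

/-- The contraction rule for independence: if `m₁` is independent of `m₂`, and both jointly are
independent of `m₃`, then `m₁` is independent of `m₂` and `m₃` jointly. -/
theorem indep_sup_of_indep {m₁ m₂ m₁₂ m₃ : MeasurableSpace Ω} [IsProbabilityMeasure μ]
    (h₁₂ : m₁₂ ≤ mΩ) (h₃ : m₃ ≤ mΩ) (hm₁ : m₁ ≤ m₁₂) (hm₂ : m₂ ≤ m₁₂) (h : Indep m₁ m₂ μ)
    (h' : Indep m₁₂ m₃ μ) : Indep m₁ (m₂ ⊔ m₃) μ := by
  set p : Set (Set Ω) := {t | ∃ a b, MeasurableSet[m₂] a ∧ MeasurableSet[m₃] b ∧ t = a ∩ b}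
    with hp
  have hgen : m₂ ⊔ m₃ = MeasurableSpace.generateFrom p := by
    refine le_antisymm (sup_le (fun t ht => ?_) fun t ht => ?_)
      (MeasurableSpace.generateFrom_le ?_)
    · exact .basic _ ⟨t, Set.univ, ht, .univ, by simp⟩
    · exact .basic _ ⟨Set.univ, t, .univ, ht, by simp⟩
    · rintro _ ⟨a, b, ha, hb, rfl⟩
      exact MeasurableSet.inter (le_sup_left (a := m₂) (b := m₃) a ha)
        (le_sup_right (a := m₂) (b := m₃) b hb)
  have hpi : IsPiSystem p := by
    rintro _ ⟨a, b, ha, hb, rfl⟩ _ ⟨a', b', ha', hb', rfl⟩ -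
    exact ⟨a ∩ a', b ∩ b', ha.inter ha', hb.inter hb', Set.inter_inter_inter_comm ..⟩
  refine IndepSets.indep (hm₁.trans h₁₂) (sup_le (hm₂.trans h₁₂) h₃)
    (@MeasurableSpace.isPiSystem_measurableSet _ m₁) hpi
    (@MeasurableSpace.generateFrom_measurableSet _ m₁).symm hgen ?_
  rw [IndepSets_iff]
  rintro t₁ _ ht₁ ⟨a, b, ha, hb, rfl⟩
  rw [Indep_iff] at h h'
  rw [← Set.inter_assoc, h' _ _ ((hm₁ _ ht₁).inter (hm₂ _ ha)) hb, h _ _ ht₁ ha,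
    h' _ _ (hm₂ _ ha) hb, mul_assoc]

theorem mutualInfo_eq_zero_iff {A B : Type*} [MeasurableSpace A] [MeasurableSpace B]
    [IsProbabilityMeasure μ] {X : Ω → A} {Y : Ω → B} (hX : Measurable X) (hY : Measurable Y) :
    mutualInfo μ X Y = 0 ↔ IndepFun X Y μ := by
  have := Measure.isProbabilityMeasure_map (μ := μ) hX.aemeasurable
  have := Measure.isProbabilityMeasure_map (μ := μ) hY.aemeasurable
  rw [mutualInfo, InformationTheory.klDiv_eq_zero_iff,
    indepFun_iff_map_prod_eq_prod_map_map hX.aemeasurable hY.aemeasurable]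

/-- A bit that is flipped by a symmetry of the probability space is independent of
everything that the symmetry fixes. -/
theorem indepFun_of_flip {B : Type*} [MeasurableSpace B] [IsProbabilityMeasure μ]
    {X : Ω → Bool} {Y : Ω → B} {T : Ω → Ω} (hT : MeasurePreserving T μ μ)
    (hX : Measurable X) (hY : Measurable Y) (hXT : ∀ ω, X (T ω) = !(X ω))
    (hYT : ∀ ω, Y (T ω) = Y ω) : IndepFun X Y μ := by
  have key : ∀ (b : Bool) (t : Set B), MeasurableSet t →
      μ (X ⁻¹' {b} ∩ Y ⁻¹' t) = 2⁻¹ * μ (Y ⁻¹' t) := by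
    intro b t ht
    have hm : ∀ b, MeasurableSet (X ⁻¹' {b} ∩ Y ⁻¹' t) := fun b =>
      (hX (measurableSet_singleton b)).inter (hY ht)
    have h1 : μ (X ⁻¹' {!b} ∩ Y ⁻¹' t) = μ (X ⁻¹' {b} ∩ Y ⁻¹' t) := by
      rw [← hT.measure_preimage (hm _).nullMeasurableSet]
      congr 1
      ext ω
      simp [hXT, hYT]
    have h2 : μ (Y ⁻¹' t) = μ (X ⁻¹' {b} ∩ Y ⁻¹' t) + μ (X ⁻¹' {!b} ∩ Y ⁻¹' t) := by
      rw [← measure_union _ (hm _)]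
      · congr 1
        ext ω
        cases h : X ω <;> cases b <;> simp [h]
      · rw [Set.disjoint_left]
        rintro ω ⟨h, -⟩ ⟨h', -⟩
        rw [Set.mem_preimage, Set.mem_singleton_iff] at h h'
        simp [h] at h'
    rw [h2, h1, ← two_mul, ← mul_assoc, ENNReal.inv_mul_cancel (by simp) (by simp), one_mul]
  have hX' : ∀ b, μ (X ⁻¹' {b}) = 2⁻¹ := fun b => by simpa using key b Set.univ .univ
  rw [indepFun_iff_measure_inter_preimage_eq_mul]
  intro A t _ ht
  by_cases h0 : false ∈ A <;> by_cases h1 : true ∈ A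
  · have : A = Set.univ := by ext b; cases b <;> simp [h0, h1]
    rw [this, Set.preimage_univ, Set.univ_inter, measure_univ, one_mul]
  · have : A = {false} := by ext b; cases b <;> simp [h0, h1]
    rw [this, key _ _ ht, hX']
  · have : A = {true} := by ext b; cases b <;> simp [h0, h1]
    rw [this, key _ _ ht, hX']
  · have : A = ∅ := by ext b; cases b <;> simp [h0, h1]
    simp [this]

end Independence

/-! ### Necessity of protection -/

section Converse

variable {V : Type*} {G : AcyclicNetwork V}

theorem adj_of_mem_inEdges {e : G.Edge} {v : V} (h : e ∈ G.inEdges v) : G.Adj (G.tail e) v :=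
  Eq.subst (motive := fun b => G.Adj (G.tail e) b) h e.2

/-- The vertices `w` for which there is an alternating path `s ⇝ y₁ ⇜ x₁ ⇝ ⋯ ⇝ y ⇜ w` that avoids
`u` and has all its colliders among the in-nodes of `u`; also `s` itself. -/
def alternatingComponent (G : AcyclicNetwork V) (s u : V) : Set V :=
  {w | Relation.ReflTransGen
    (fun a b => ∃ y, G.Adj y u ∧ G.ReachableAvoiding u a y ∧ G.ReachableAvoiding u b y) s w}

theorem mem_alternatingComponent_self (s u : V) : s ∈ G.alternatingComponent s u :=
  Relation.ReflTransGen.refl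

theorem ne_of_mem_alternatingComponent {s u w : V} (hs : s ≠ u)
    (hw : w ∈ G.alternatingComponent s u) : w ≠ u := by
  cases (hw : Relation.ReflTransGen _ s w) with
  | refl => exact hs
  | tail _ h =>
    obtain ⟨_, -, -, h⟩ := h
    exact h.1

/-- The chains of `alternatingComponent` in the format of `IsProtected`. -/
theorem exists_chain_of_mem_alternatingComponent {s u w : V}
    (hw : w ∈ G.alternatingComponent s u) (hne : w ≠ s) :
    ∃ (l : ℕ) (x y : ℕ → V), 1 ≤ l ∧
      G.ReachableAvoiding u s (y 1) ∧
      (∀ k, 1 ≤ k → k ≤ l → G.ReachableAvoiding u (x k) (y k)) ∧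
      (∀ k, 1 ≤ k → k < l → G.ReachableAvoiding u (x k) (y (k + 1))) ∧
      x l = w ∧
      (∀ k, 1 ≤ k → k ≤ l → G.Adj (y k) u) := by
  classical
  induction (hw : Relation.ReflTransGen _ s w) with
  | refl => exact absurd rfl hne
  | @tail a b ha hab ih =>
    obtain ⟨y', hy', hay, hby⟩ := hab
    by_cases has : a = s
    · subst has
      refine ⟨1, fun _ => b, fun _ => y', le_rfl, hay, fun _ _ _ => hby, ?_, rfl,
        fun _ _ _ => hy'⟩
      intro k h1 h2
      omega
    · obtain ⟨l, x, y, hl, h1, h2, h3, h4, h5⟩ := ih has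
      refine ⟨l + 1, Function.update x (l + 1) b, Function.update y (l + 1) y', by omega,
        ?_, ?_, ?_, by simp, ?_⟩
      · rwa [Function.update_of_ne (by omega)]
      · intro k hk1 hk2
        rcases hk2.eq_or_lt with rfl | hk
        · simpa using hby
        · rw [Function.update_of_ne hk.ne, Function.update_of_ne hk.ne]
          exact h2 k hk1 (by omega)
      · intro k hk1 hk2
        rw [Function.update_of_ne hk2.ne]
        rcases (Nat.lt_succ_iff.mp hk2).eq_or_lt with rfl | hk
        · simpa [h4] using hay
        · rw [Function.update_of_ne (by omega)]
          exact h3 k hk1 hk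
      · intro k hk1 hk2
        rcases hk2.eq_or_lt with rfl | hk
        · simpa using hy'
        · rw [Function.update_of_ne hk.ne]
          exact h5 k hk1 (by omega)

theorem isProtected_of_mem_alternatingComponent {s d u w : V} (hcut : G.IsCutVertex s d u)
    (hw : w ∈ G.alternatingComponent s u) (hwd : G.ReachableAvoiding u w d) :
    G.IsProtected s d u := by
  have hne : w ≠ s := by
    rintro rfl
    exact hcut.2.2 hwd
  obtain ⟨l, x, y, hl, h1, h2, h3, rfl, h5⟩ :=
    exists_chain_of_mem_alternatingComponent hw hne
  exact ⟨l, x, y, hl, h1, h2, h3, hwd, h5⟩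

namespace NetworkCode

variable [Fintype V] (C : G.NetworkCode)

/-- A message is measurable for every σ-algebra that knows the information from which it is
encoded. -/
theorem measurable_message_of {m : MeasurableSpace (Outcome V)} (e : G.Edge)
    (h : ∀ e' ∈ G.inEdges (G.tail e), Measurable[m] fun ω => C.message ω e')
    (hb : Measurable[m] fun ω : Outcome V => ω (G.tail e)) :
    Measurable[m] fun ω => C.message ω e := by
  simp_rw [C.message_eq _ e]
  exact (C.measurable_encode e).comp
    (Measurable.prodMk (measurable_pi_lambda _ fun e' => h e'.1 e'.2) hb)

theorem measurable_message (e : G.Edge) : Measurable fun ω => C.message ω e := by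
  induction e using G.precedes_wf.induction with
  | _ e ih => exact C.measurable_message_of e ih (measurable_pi_apply _)

theorem measurable_messagesOn (β : Set G.Edge) : Measurable (C.messagesOn β) :=
  measurable_pi_lambda _ fun e => C.measurable_message e.1

/-- Messages leaving a vertex are functions of the bits of `S` if all ancestors of that vertex
lie in `S`. -/
theorem measurable_message_of_ancestors (S : Set V) (e : G.Edge)
    (h : ∀ w, G.Reachable w (G.tail e) → w ∈ S) :
    Measurable[bitsSigma S] fun ω => C.message ω e := by
  induction e using G.precedes_wf.induction with
  | _ e ih =>
    refine C.measurable_message_of e (fun e' he' => ih e' he' fun w hw => h w ?_)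
      (measurable_bitsSigma (h _ .refl))
    exact hw.tail (adj_of_mem_inEdges he')

/-- The σ-algebra generated by the messages on the edges in `β`. -/
@[reducible]
def messagesSigma (β : Set G.Edge) : MeasurableSpace (Outcome V) :=
  MeasurableSpace.comap (C.messagesOn β) inferInstance

end NetworkCode

/-- The σ-algebra generated by the `j`-th bit of `s`. -/
@[reducible]
def bitSigma (s : V) (j : ℕ) : MeasurableSpace (Outcome V) :=
  MeasurableSpace.comap (fun ω : Outcome V => ω s j) inferInstance

/-- Zero information at an unprotected cut vertex `u` rules out that a bit of the source is a
function of the information at the terminal: the messages into `u` that are influenced by the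
alternating component of `s` are functions of the bits of that component, and, given them, the
information at `d` is a function of the bits of the complement. -/
theorem not_decodable_of_not_isProtected [Fintype V] (C : G.NetworkCode) {s d u : V}
    (hcut : G.IsCutVertex s d u) (hprot : ¬ G.IsProtected s d u) (j : ℕ)
    (hind : IndepFun (fun ω : Outcome V => ω s j) (C.messagesOn (G.inEdges u)) (bitsLaw V))
    (g : (∀ e : G.inEdges d, C.alphabet e.1) × (ℕ → Bool) → Bool) (hg : Measurable g) :
    ¬ ∀ᵐ ω ∂bitsLaw V, g (C.infoAt d ω) = ω s j := by
  intro hdec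
  have hsu : s ≠ u := hcut.1.symm
  set S := G.alternatingComponent s u with hS
  have huS : u ∈ Sᶜ := fun h => ne_of_mem_alternatingComponent hsu h rfl
  -- `P` holds the vertices that the component does not influence except through `u`.
  set P : Set V := {v | ∀ w ∈ S, ¬ G.ReachableAvoiding u w v} with hP
  have hdP : d ∈ P := fun w hw h =>
    hprot (isProtected_of_mem_alternatingComponent hcut hw h)
  have hPS : ∀ v ∈ P, v ∈ Sᶜ := fun v hv hvS =>
    hv v hvS (.refl (ne_of_mem_alternatingComponent hsu hvS))
  have hPpred : ∀ a b, G.Adj a b → b ∈ P → b ≠ u → a ≠ u → a ∈ P := fun a b hab hb hbu _ w hw h =>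
    hb w hw ⟨h.1, h.2.tail ⟨hab, hbu⟩⟩
  set β : Set G.Edge := {e | G.head e = u ∧ G.tail e ∉ P} with hβ
  have hMmeas : ∀ e ∈ β, Measurable[C.messagesSigma β] fun ω => C.message ω e := fun e he =>
    (measurable_pi_apply (⟨e, he⟩ : β)).comp (comap_measurable (C.messagesOn β))
  have hMS : C.messagesSigma β ≤ bitsSigma S := by
    refine Measurable.comap_le (@measurable_pi_lambda _ _ _ (bitsSigma S) _ _ fun e => ?_)
    obtain ⟨e, he, heP⟩ := e
    refine C.measurable_message_of_ancestors S e fun w hw => ?_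
    have hadj : G.Adj (G.tail e) u := adj_of_mem_inEdges he
    simp only [hP, Set.mem_ofPred_eq, not_forall, not_not] at heP
    obtain ⟨w', hw', h'⟩ := heP
    exact Relation.ReflTransGen.tail hw' ⟨_, hadj, h', hw.avoiding_of_adj hadj⟩
  have hKS : bitSigma s j ≤ bitsSigma S := by
    have h : Measurable[bitsSigma S] fun ω : Outcome V => ω s j :=
      (measurable_pi_apply j).comp (measurable_bitsSigma (mem_alternatingComponent_self s u))
    exact h.comap_le
  have hKM : Indep (bitSigma s j) (C.messagesSigma β) (bitsLaw V) := by
    refine indep_of_indep_of_le_right hind (Measurable.comap_le ?_)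
    refine @measurable_pi_lambda _ _ _ (C.messagesSigma (G.inEdges u)) _ _ fun e => ?_
    exact (measurable_pi_apply (⟨e.1, e.2.1⟩ : G.inEdges u)).comp
      (comap_measurable (C.messagesOn (G.inEdges u)))
  have hindep : Indep (bitSigma s j) (C.messagesSigma β ⊔ bitsSigma Sᶜ) (bitsLaw V) :=
    indep_sup_of_indep (bitsSigma_le S) (bitsSigma_le Sᶜ) hKS hMS hKM
      (indep_bitsSigma_compl S)
  have hbit : ∀ v ∈ Sᶜ,
      Measurable[C.messagesSigma β ⊔ bitsSigma Sᶜ] fun ω : Outcome V => ω v := fun v hv =>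
    (measurable_bitsSigma hv).mono le_sup_right le_rfl
  have hmsg : ∀ e : G.Edge, G.tail e ∈ P ∨ G.tail e = u ∨ G.head e = u →
      Measurable[C.messagesSigma β ⊔ bitsSigma Sᶜ] fun ω => C.message ω e := by
    intro e
    induction e using G.precedes_wf.induction with
    | _ e ih =>
      intro he
      by_cases hu : G.tail e = u
      · exact C.measurable_message_of e
          (fun e' he' => ih e' he' (.inr (.inr (Eq.trans he' hu)))) (hbit _ (hu ▸ huS))
      by_cases htP : G.tail e ∈ P
      · refine C.measurable_message_of e (fun e' he' => ih e' he' ?_) (hbit _ (hPS _ htP))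
        by_cases h' : G.tail e' = u
        · exact .inr (.inl h')
        · exact .inl (hPpred _ _ (adj_of_mem_inEdges he') htP hu h')
      · have hh : G.head e = u := (he.resolve_left htP).resolve_left hu
        exact (hMmeas e ⟨hh, htP⟩).mono le_sup_left le_rfl
  have hinfo : Measurable[C.messagesSigma β ⊔ bitsSigma Sᶜ] (C.infoAt d) := by
    refine Measurable.prodMk (@measurable_pi_lambda _ _ _
      (C.messagesSigma β ⊔ bitsSigma Sᶜ) _ _ fun e => hmsg e.1 ?_) (hbit d (hPS d hdP))
    by_cases h' : G.tail e.1 = u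
    · exact .inr (.inl h')
    · exact .inl (hPpred _ _ (adj_of_mem_inEdges e.2) hdP hcut.2.1.symm h')
  have hgi : Measurable[C.messagesSigma β ⊔ bitsSigma Sᶜ] fun ω => g (C.infoAt d ω) :=
    hg.comp hinfo
  rw [Indep_iff] at hindep
  -- Now the event `ω s j = true` would be independent of itself.
  have h1 := hindep {ω | ω s j = true} {ω | g (C.infoAt d ω) = true}
    ⟨{true}, measurableSet_singleton _, rfl⟩ (hgi (measurableSet_singleton true))
  have hae : ({ω | g (C.infoAt d ω) = true} : Set (Outcome V)) =ᵐ[bitsLaw V]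
      {ω | ω s j = true} := by
    filter_upwards [hdec] with ω hω
    exact congrArg (· = true) hω
  rw [measure_congr hae, measure_congr ((Filter.EventuallyEq.refl _ _).inter hae),
    Set.inter_self, bitsLaw_bit] at h1
  have h2 : (2⁻¹ : ℝ≥0∞).toReal = (2⁻¹ * 2⁻¹ : ℝ≥0∞).toReal := congrArg _ h1
  norm_num at h2

/-- Only protected cut vertices are compatible with secure multicast. -/
theorem isProtected_of_hasSecureMulticastRate [Fintype V] {s : V} {D : Set V}
    (hD : ∀ d ∈ D, ∀ v, ¬ G.Adj d v) (hreach : ∀ d ∈ D, G.Reachable s d) {R : ℝ} (hR : 0 < R)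
    (h : G.HasSecureMulticastRate s D (G.nodeEavesdroppers s D) R) {d : V} (hd : d ∈ D) {u : V}
    (hcut : G.IsCutVertex s d u) : G.IsProtected s d u := by
  by_contra hprot
  obtain ⟨C, J, φ, K, hK, hdec, hsec⟩ := h
  have hud : G.Reachable u d := ((hreach d hd).avoiding_or u).resolve_left hcut.2.2
  have huD : u ∉ D := by
    intro hu
    rcases Relation.ReflTransGen.cases_head hud with h | ⟨v, hv, -⟩
    · exact hcut.2.1 h
    · exact hD u hu v hv
  -- A positive rate means at least two messages, hence at least one secret bit.
  have hJ : J.Nonempty := by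
    by_contra hJ
    rw [Finset.not_nonempty_iff_eq_empty] at hJ
    subst hJ
    have hcard := Fintype.card_congr φ
    have h2 : (1 : ℝ) < 2 ^ R := Real.one_lt_rpow (by norm_num) hR
    have h3 : 1 < ⌈(2 : ℝ) ^ R⌉₊ := Nat.lt_ceil.mpr (by exact_mod_cast h2)
    simp at hcard
    omega
  obtain ⟨j, hj⟩ := hJ
  have hKm : Measurable K := by
    have : K = fun ω => φ fun j => ω s j := funext hK
    rw [this]
    exact (measurable_of_countable φ).comp
      (measurable_pi_lambda _ fun j : J =>
        (measurable_pi_apply (j : ℕ)).comp (measurable_pi_apply s))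
  have hψ : ∀ ω, φ.symm (K ω) ⟨j, hj⟩ = ω s j := fun ω => by simp [hK]
  have hind := (mutualInfo_eq_zero_iff hKm (C.measurable_messagesOn _)).1
    (hsec (G.inEdges u) ⟨u, by simp [huD, hcut.1], rfl⟩)
  obtain ⟨g, hg, hgK⟩ := hdec d hd
  refine not_decodable_of_not_isProtected C hcut hprot j ?_
    (fun i => φ.symm (g i) ⟨j, hj⟩)
    ((measurable_of_countable fun k => φ.symm k ⟨j, hj⟩).comp hg) ?_
  · have := hind.comp (measurable_of_countable fun k => φ.symm k ⟨j, hj⟩) measurable_id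
    simpa only [Function.comp_def, hψ, id] using this
  · filter_upwards [hgK] with ω hω
    rw [hω, hψ]

end Converse

/-! ### Unit flows modulo two -/

section Flows

open scoped Classical

variable {V : Type*} {G : AcyclicNetwork V}

/-- The pair `(a, b)` is an edge from whose head `d` can be reached. -/
def Active (G : AcyclicNetwork V) (d a b : V) : Prop := G.Adj a b ∧ G.Reachable b d

variable [Fintype V]

/-- A flow of value one from `s` to `t` with coefficients in `ZMod 2`, supported on the active
edges for `d` and vanishing on the edges into `u`.  Modulo two the orientation of the edges is
immaterial: the condition says that the boundary of the chain `z` is `s + t`. -/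
structure IsUnitFlow (G : AcyclicNetwork V) (d u s t : V) (z : V → V → ZMod 2) : Prop where
  eq_zero : ∀ a b, ¬ G.Active d a b → z a b = 0
  eq_zero_right : ∀ a, z a u = 0
  boundary : ∀ v, ∑ b, z v b + ∑ b, z b v = (if v = s then 1 else 0) + if v = t then 1 else 0

theorem isUnitFlow_zero (d u s : V) : G.IsUnitFlow d u s s 0 where
  eq_zero _ _ _ := rfl
  eq_zero_right _ := rfl
  boundary v := by simp [CharTwo.add_self_eq_zero]

/-- A unit flow is prolonged along an edge, in either direction. -/
theorem IsUnitFlow.prolong {d u s t t' a b : V} {z : V → V → ZMod 2}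
    (hz : G.IsUnitFlow d u s t z) (hab : G.Active d a b) (hb : b ≠ u)
    (h : t = a ∧ t' = b ∨ t = b ∧ t' = a) :
    G.IsUnitFlow d u s t' fun x y => z x y + if x = a ∧ y = b then 1 else 0 where
  eq_zero x y hxy := by
    have : ¬ (x = a ∧ y = b) := by
      rintro ⟨rfl, rfl⟩
      exact hxy hab
    simp [hz.eq_zero x y hxy, this]
  eq_zero_right x := by simp [hz.eq_zero_right x, hb.symm]
  boundary v := by
    have h1 : ∑ y, (if v = a ∧ y = b then (1 : ZMod 2) else 0) = if v = a then 1 else 0 := by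
      by_cases hv : v = a <;> simp [hv]
    have h2 : ∑ x, (if x = a ∧ v = b then (1 : ZMod 2) else 0) = if v = b then 1 else 0 := by
      by_cases hv : v = b <;> simp [hv]
    rw [Finset.sum_add_distrib, Finset.sum_add_distrib, h1, h2, add_add_add_comm,
      hz.boundary v]
    have h3 : ∀ p q r : ZMod 2, p + q + (q + r) = p + r := by decide
    have h4 : ∀ p q r : ZMod 2, p + q + (r + q) = p + r := by decide
    rcases h with ⟨rfl, rfl⟩ | ⟨rfl, rfl⟩
    · exact h3 _ _ _
    · exact h4 _ _ _

theorem ReachableAvoiding.exists_isUnitFlow_iff {d u s a b : V} (h : G.ReachableAvoiding u a b)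
    (hb : G.Reachable b d) :
    (∃ z, G.IsUnitFlow d u s a z) ↔ ∃ z, G.IsUnitFlow d u s b z := by
  induction h.2 using Relation.ReflTransGen.head_induction_on with
  | refl => rfl
  | @head a c hac hcb ih =>
    have hc : G.Reachable c d := (ReachableAvoiding.reachable ⟨hac.2, hcb⟩).trans hb
    rw [← ih ⟨hac.2, hcb⟩]
    exact ⟨fun ⟨z, hz⟩ => ⟨_, hz.prolong ⟨hac.1, hc⟩ hac.2 (.inl ⟨rfl, rfl⟩)⟩,
      fun ⟨z, hz⟩ => ⟨_, hz.prolong ⟨hac.1, hc⟩ hac.2 (.inr ⟨rfl, rfl⟩)⟩⟩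

/-- An alternating path that avoids a cut vertex carries a unit flow.  Its vertices can all reach
`d`, because its colliders are in-nodes of `u`. -/
theorem IsProtected.exists_isUnitFlow {s d u : V} (h : G.IsProtected s d u)
    (hu : G.Reachable u d) : ∃ z, G.IsUnitFlow d u s d z := by
  obtain ⟨l, x, y, hl, h1, h2, h3, h4, h5⟩ := h
  have hy : ∀ k, 1 ≤ k → k ≤ l → G.Reachable (y k) d := fun k hk hkl =>
    Relation.ReflTransGen.head (h5 k hk hkl) hu
  have hx : ∀ k, 1 ≤ k → k ≤ l → ∃ z, G.IsUnitFlow d u s (x k) z := by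
    intro k hk
    induction k, hk using Nat.le_induction with
    | base =>
      intro hkl
      rw [(h2 1 le_rfl hkl).exists_isUnitFlow_iff (hy 1 le_rfl hkl),
        ← h1.exists_isUnitFlow_iff (hy 1 le_rfl hkl)]
      exact ⟨0, isUnitFlow_zero d u s⟩
    | succ k hk ih =>
      intro hkl
      rw [(h2 _ (by omega) hkl).exists_isUnitFlow_iff (hy _ (by omega) hkl),
        ← (h3 k hk hkl).exists_isUnitFlow_iff (hy _ (by omega) hkl)]
      exact ih (by omega)
  exact (h4.exists_isUnitFlow_iff .refl).1 (hx l hl le_rfl)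

theorem exists_isUnitFlow {s d u : V} (hsd : G.Reachable s d) (hs : u ≠ s) (hd : u ≠ d)
    (h : G.IsCutVertex s d u → G.IsProtected s d u) : ∃ z, G.IsUnitFlow d u s d z := by
  by_cases hr : G.ReachableAvoiding u s d
  · exact (hr.exists_isUnitFlow_iff .refl).1 ⟨0, isUnitFlow_zero d u s⟩
  · exact (h ⟨hs, hd, hr⟩).exists_isUnitFlow ((hsd.avoiding_or u).resolve_left hr)

end Flows

/-! ### Random flows -/

section RandomFlow

open scoped Classical

variable {V : Type*} {G : AcyclicNetwork V}

/-- An out-neighbour of `a` from which `d` can be reached, if there is one. -/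
def next (G : AcyclicNetwork V) (d a : V) : V :=
  if h : ∃ b, G.Active d a b then h.choose else a

theorem active_next {d a b : V} (h : G.Active d a b) : G.Active d a (G.next d a) := by
  have h' : ∃ b, G.Active d a b := ⟨b, h⟩
  rw [next, dif_pos h']
  exact h'.choose_spec

variable [Fintype V]

theorem sum_eq_add_sum_active {d a : V} {g : V → ZMod 2}
    (hg : ∀ b, ¬ G.Active d a b → g b = 0) (n : V) :
    ∑ b, g b = g n + ∑ b with G.Active d a b ∧ b ≠ n, g b := by
  rw [← Finset.add_sum_erase _ _ (Finset.mem_univ n), Finset.sum_filter]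
  congr 1
  refine Eq.trans ?_ (Finset.sum_erase (a := n) _ (by simp))
  refine Finset.sum_congr rfl fun b hb => ?_
  have hbn : b ≠ n := Finset.ne_of_mem_erase hb
  by_cases h : G.Active d a b
  · simp [h, hbn]
  · simp [h, hg b h]

/-- The local rule of the random flow to `d`: if `x c` is the flow on the edge `(c, a)` and `r`
consists of the bits of `a`, then `flowRule s d a b x r` is the flow on `(a, b)`.  Active edges
carry fresh bits, except that the one to `next d a` balances the flow through `a`, where the secret
bit `r none` enters at `s`. -/
def flowRule (G : AcyclicNetwork V) (s d a b : V) (x : V → ZMod 2)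
    (r : Option (V × V) → ZMod 2) : ZMod 2 :=
  if G.Active d a b then
    if b = G.next d a then
      ∑ c, x c + (if a = s then r none else 0) +
        ∑ b' with G.Active d a b' ∧ b' ≠ b, r (some (d, b'))
    else r (some (d, b))
  else 0

/-- `f` is the flow to `d` determined by the bits `r`. -/
def IsRandomFlow (G : AcyclicNetwork V) (s d : V) (r : V → Option (V × V) → ZMod 2)
    (f : V → V → ZMod 2) : Prop :=
  ∀ a b, f a b = G.flowRule s d a b (fun c => f c a) (r a)

namespace IsRandomFlow

variable {s d : V} {r r' : V → Option (V × V) → ZMod 2} {f f' : V → V → ZMod 2}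

theorem eq_zero (hf : G.IsRandomFlow s d r f) {a b : V} (h : ¬ G.Active d a b) : f a b = 0 := by
  rw [hf, flowRule, if_neg h]

theorem conservation (hf : G.IsRandomFlow s d r f) (hsd : G.Reachable s d) {a : V}
    (ha : a ≠ d) : ∑ b, f a b = ∑ c, f c a + if a = s then r a none else 0 := by
  by_cases h : ∃ b, G.Active d a b
  · obtain ⟨b, hb⟩ := h
    have hn := active_next hb
    set n := G.next d a with hn'
    have h1 : ∑ b, f a b = f a n + ∑ b with G.Active d a b ∧ b ≠ n, r a (some (d, b)) := by
      rw [sum_eq_add_sum_active (fun b => hf.eq_zero) n]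
      congr 1
      refine Finset.sum_congr rfl fun b hb => ?_
      obtain ⟨-, hb, hbn⟩ := Finset.mem_filter.1 hb
      rw [hf, flowRule, if_pos hb, if_neg (hn' ▸ hbn)]
    have h2 : f a n = ∑ c, f c a + (if a = s then r a none else 0) +
        ∑ b with G.Active d a b ∧ b ≠ n, r a (some (d, b)) := by
      conv_lhs => rw [hf, flowRule, if_pos hn, if_pos hn']
    rw [h1, h2, add_assoc, CharTwo.add_self_eq_zero, add_zero]
  · -- A vertex other than `d` without active out-edges cannot reach `d`.
    have had : ¬ G.Reachable a d := by
      intro h'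
      rcases Relation.ReflTransGen.cases_head h' with h' | ⟨b, hab, hb⟩
      · exact ha h'
      · exact h ⟨b, hab, hb⟩
    have has : a ≠ s := by
      rintro rfl
      exact had hsd
    rw [Finset.sum_eq_zero fun b _ => hf.eq_zero fun hb => h ⟨b, hb⟩,
      Finset.sum_eq_zero fun c _ => hf.eq_zero fun hc => had hc.2, if_neg has, add_zero]

/-- The flow arriving at `d` is the secret bit. -/
theorem sum_terminal (hf : G.IsRandomFlow s d r f) (hsd : G.Reachable s d)
    (hd : ∀ v, ¬ G.Adj d v) :
    ∑ c, f c d + (if s = d then r s none else 0) = r s none := by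
  have hout : ∑ b, f d b = 0 := Finset.sum_eq_zero fun b _ => hf.eq_zero fun h => hd b h.1
  have h1 : ∀ a, ∑ b, f a b = ∑ c, f c a + (if a = s then r a none else 0) +
      if a = d then ∑ c, f c d + (if s = d then r s none else 0) else 0 := by
    intro a
    by_cases ha : a = d
    · subst ha
      rw [hout, if_pos rfl]
      by_cases hs : s = a
      · subst hs
        simp [CharTwo.add_self_eq_zero]
      · simp [hs, Ne.symm hs, CharTwo.add_self_eq_zero]
    · rw [hf.conservation hsd ha, if_neg ha, add_zero]
  have h2 : ∑ a, ∑ b, f a b = ∑ a, ∑ c, f c a + r s none +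
      (∑ c, f c d + if s = d then r s none else 0) := by
    rw [Finset.sum_congr rfl fun a _ => h1 a, Finset.sum_add_distrib, Finset.sum_add_distrib]
    simp
  rw [Finset.sum_comm (f := fun a c => f c a), add_assoc, left_eq_add] at h2
  exact (CharTwo.add_eq_zero.1 h2).symm

/-- Adding a unit flow `z` to the bits and flipping the secret changes the random flow by `z`. -/
theorem eq_add (hf : G.IsRandomFlow s d r f) (hf' : G.IsRandomFlow s d r' f')
    (hd : ∀ v, ¬ G.Adj d v) {u : V} {z : V → V → ZMod 2} (hz : G.IsUnitFlow d u s d z)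
    (hr : ∀ a b, r' a (some (d, b)) = r a (some (d, b)) + z a b)
    (hs : r' s none = r s none + 1) (a b : V) : f' a b = f a b + z a b := by
  suffices h : ∀ e : G.Edge, f' (G.tail e) (G.head e) =
      f (G.tail e) (G.head e) + z (G.tail e) (G.head e) by
    by_cases hab : G.Adj a b
    · exact h ⟨(a, b), hab⟩
    · have h' : ¬ G.Active d a b := fun h => hab h.1
      rw [hf.eq_zero h', hf'.eq_zero h', hz.eq_zero _ _ h', add_zero]
  intro e
  induction e using G.precedes_wf.induction with
  | _ e ih =>
    set a := G.tail e with ha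
    set b := G.head e with hb
    by_cases hact : G.Active d a b
    swap
    · rw [hf.eq_zero hact, hf'.eq_zero hact, hz.eq_zero _ _ hact, add_zero]
    have had : a ≠ d := by
      rintro h
      exact hd b (h ▸ hact.1)
    by_cases hn : b = G.next d a
    swap
    · rw [hf', hf, flowRule, flowRule, if_pos hact, if_neg hn, if_pos hact, if_neg hn, hr]
    have hin : ∀ c, f' c a = f c a + z c a := by
      intro c
      by_cases hca : G.Adj c a
      · exact ih ⟨(c, a), hca⟩ rfl
      · have h' : ¬ G.Active d c a := fun h => hca h.1
        rw [hf.eq_zero h', hf'.eq_zero h', hz.eq_zero _ _ h', add_zero]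
    have hsecret : (if a = s then r' a none else 0) =
        (if a = s then r a none else 0) + if a = s then 1 else 0 := by
      by_cases h : a = s
      · simp only [h, if_true, hs]
      · simp only [h, if_false, add_zero]
    have hbd := hz.boundary a
    rw [if_neg had, add_zero, sum_eq_add_sum_active (hz.eq_zero a) b] at hbd
    rw [hf', hf, flowRule, flowRule, if_pos hact, if_pos hn, if_pos hact, if_pos hn, hsecret]
    simp only [hin, hr, Finset.sum_add_distrib]
    have key : ∀ x y w p q t k : ZMod 2, p + q + x = k →
        w + x + (y + k) + (t + q) = w + y + t + p := by decide
    exact key _ _ _ _ _ _ _ hbd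

end IsRandomFlow

end RandomFlow

/-! ### The code built from random flows -/

section FlowCode

open scoped Classical

/-- A bit as an element of `ZMod 2`. -/
def bitVal (b : Bool) : ZMod 2 := if b then 1 else 0

theorem bitVal_xor (a b : Bool) : bitVal (xor a b) = bitVal a + bitVal b := by
  revert a b; decide

theorem bitVal_decide (x : ZMod 2) : bitVal (decide (x = 1)) = x := by
  rw [bitVal]
  revert x
  decide

theorem decide_bitVal (b : Bool) : decide (bitVal b = 1) = b := by
  cases b <;> simp [bitVal]

/-- Labels of the bits that a vertex uses: `none` stands for the secret bit, `some (d, b)` for the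
fresh bit on the edge to `b` in the flow to `d`. -/
def bitIndex (V : Type*) [Fintype V] : Option (V × V) → ℕ :=
  (Countable.exists_injective_nat (Option (V × V))).choose

theorem bitIndex_injective (V : Type*) [Fintype V] : Function.Injective (bitIndex V) :=
  (Countable.exists_injective_nat (Option (V × V))).choose_spec

instance {V : Type*} [Finite V] (G : AcyclicNetwork V) : Finite G.Edge :=
  inferInstanceAs (Finite {e : V × V // G.Adj e.1 e.2})

/-- Functions of finitely many messages and finitely many bits are measurable. -/
theorem measurable_of_finite_data {I O A B : Type*} [Finite I] [Finite O] [Finite A]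
    (ι : O → ℕ) (F : (I → A) → (O → Bool) → B) :
    @Measurable ((I → A) × (ℕ → Bool)) B
      (@Prod.instMeasurableSpace _ _ (@MeasurableSpace.pi _ _ fun _ => ⊤) inferInstance) ⊤
      fun p => F p.1 fun o => p.2 (ι o) := by
  let : MeasurableSpace A := ⊤
  let : MeasurableSpace B := ⊤
  have : DiscreteMeasurableSpace A := ⟨fun _ => trivial⟩
  have h : Measurable fun p : (I → A) × (O → Bool) => F p.1 p.2 := measurable_of_countable _
  exact h.comp (measurable_fst.prodMk (measurable_pi_lambda _ fun o =>
    (measurable_pi_apply (ι o)).comp measurable_snd))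

variable {V : Type*} [Fintype V] {G : AcyclicNetwork V}

/-- The messages on the edges into `v`, as functions on the vertices; `0` off the in-nodes. -/
def inFlow (G : AcyclicNetwork V) (v : V) {I : Type*} (x : G.inEdges v → I → ZMod 2) (i : I)
    (c : V) : ZMod 2 :=
  if h : G.Adj c v then x ⟨⟨(c, v), h⟩, rfl⟩ i else 0

/-- The code that sends independent random flows to all terminals `d ∈ D`, all of them with the
same secret bit.  The coordinates of the messages are indexed by `Fin (Fintype.card V) ≃ V`, as
alphabets live in `Type`. -/
def flowCode (G : AcyclicNetwork V) (s : V) (D : Set V) : G.NetworkCode where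
  alphabet _ := Fin (Fintype.card V) → ZMod 2
  fintypeAlphabet _ := inferInstance
  encode e p i :=
    if (Fintype.equivFin V).symm i ∈ D then
      G.flowRule s ((Fintype.equivFin V).symm i) (G.tail e) (G.head e)
        (G.inFlow (G.tail e) p.1 i) fun o => bitVal (p.2 (bitIndex V o))
    else 0
  measurable_encode e :=
    measurable_of_finite_data (bitIndex V) fun (x : G.inEdges (G.tail e) → _) r i =>
      if (Fintype.equivFin V).symm i ∈ D then
        G.flowRule s ((Fintype.equivFin V).symm i) (G.tail e) (G.head e)
          (G.inFlow (G.tail e) x i) fun o => bitVal (r o)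
      else 0

/-- The flow to `d` under `flowCode`. -/
def codeFlow (G : AcyclicNetwork V) (s : V) (D : Set V) (ω : Outcome V) (d a b : V) : ZMod 2 :=
  G.inFlow b ((G.flowCode s D).messagesOn (G.inEdges b) ω) (Fintype.equivFin V d) a

theorem codeFlow_of_adj (s : V) (D : Set V) (ω : Outcome V) (d : V) {a b : V} (h : G.Adj a b) :
    G.codeFlow s D ω d a b =
      (G.flowCode s D).message ω ⟨(a, b), h⟩ (Fintype.equivFin V d) :=
  dif_pos h

theorem codeFlow_of_not_adj (s : V) (D : Set V) (ω : Outcome V) (d : V) {a b : V}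
    (h : ¬ G.Adj a b) : G.codeFlow s D ω d a b = 0 :=
  dif_neg h

theorem message_flowCode (s : V) (D : Set V) (ω : Outcome V) (e : G.Edge)
    (i : Fin (Fintype.card V)) : (G.flowCode s D).message ω e i =
      G.codeFlow s D ω ((Fintype.equivFin V).symm i) (G.tail e) (G.head e) := by
  refine Eq.trans ?_ (codeFlow_of_adj s D ω _ e.2).symm
  rw [Equiv.apply_symm_apply]
  rfl

theorem isRandomFlow_codeFlow (s : V) {D : Set V} {d : V} (hd : d ∈ D) (ω : Outcome V) :
    G.IsRandomFlow s d (fun a o => bitVal (ω a (bitIndex V o))) (G.codeFlow s D ω d) := by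
  intro a b
  by_cases hab : G.Adj a b
  · rw [codeFlow_of_adj s D ω d hab]
    refine (congrFun (NetworkCode.message_eq (G.flowCode s D) ω _) _).trans ?_
    change (if (Fintype.equivFin V).symm _ ∈ D then G.flowRule s _ a b
      (G.inFlow a ((G.flowCode s D).messagesOn (G.inEdges a) ω) _) _ else 0) = _
    rw [Equiv.symm_apply_apply, if_pos hd]
    rfl
  · have h : ¬ G.Active d a b := fun h => hab h.1
    rw [codeFlow_of_not_adj s D ω d hab, flowRule, if_neg h]

theorem message_flowCode_of_notMem (s : V) {D : Set V} (ω : Outcome V) (e : G.Edge)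
    {i : Fin (Fintype.card V)} (hi : (Fintype.equivFin V).symm i ∉ D) :
    (G.flowCode s D).message ω e i = 0 := by
  rw [NetworkCode.message_eq]
  exact if_neg hi

/-- The bits that are flipped to exchange the two values of the secret: the secret bit itself and
the bits that carry the flows `z d`. -/
def flipBits (s : V) (z : V → V → V → ZMod 2) (a : V) : ℕ → Bool :=
  Function.extend (bitIndex V) (fun o => match o with
    | none => decide (a = s)
    | some (d, b) => decide (z d a b = 1)) fun _ => false

theorem flipBits_none (s : V) (z : V → V → V → ZMod 2) :
    flipBits s z s (bitIndex V none) = true := by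
  simp [flipBits, (bitIndex_injective V).extend_apply]

theorem bitVal_flipBits_some (s : V) (z : V → V → V → ZMod 2) (a d b : V) :
    bitVal (flipBits s z a (bitIndex V (some (d, b)))) = z d a b := by
  rw [flipBits, (bitIndex_injective V).extend_apply]
  exact bitVal_decide _

/-- The secret bit is independent of the messages into `u` if for each terminal there is a unit
flow that avoids the edges into `u`. -/
theorem indepFun_flowCode {s u : V} {D : Set V} (hD : ∀ d ∈ D, ∀ v, ¬ G.Adj d v)
    (hu : ∀ d ∈ D, ∃ z, G.IsUnitFlow d u s d z) :
    IndepFun (fun ω : Outcome V => ω s (bitIndex V none))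
      ((G.flowCode s D).messagesOn (G.inEdges u)) (bitsLaw V) := by
  have hu' : ∀ d, ∃ z, d ∈ D → G.IsUnitFlow d u s d z := by
    intro d
    by_cases hd : d ∈ D
    · obtain ⟨z, hz⟩ := hu d hd
      exact ⟨z, fun _ => hz⟩
    · exact ⟨0, fun h => absurd h hd⟩
  choose z hz using hu'
  refine indepFun_of_flip (measurePreserving_xor (flipBits s z))
    ((measurable_pi_apply _).comp (measurable_pi_apply s))
    ((G.flowCode s D).measurable_messagesOn _) (fun ω => ?_) fun ω => ?_
  · change xor _ (flipBits s z s (bitIndex V none)) = _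
    rw [flipBits_none, Bool.xor_true]
  · funext e
    obtain ⟨e, he⟩ := e
    have he' : G.head e = u := he
    funext i
    change (G.flowCode s D).message _ e i = (G.flowCode s D).message _ e i
    by_cases hi : (Fintype.equivFin V).symm i ∈ D
    · rw [message_flowCode, message_flowCode, he',
        (isRandomFlow_codeFlow s hi ω).eq_add (isRandomFlow_codeFlow s hi _) (hD _ hi) (hz _ hi)
          (fun a b => by rw [bitVal_xor, bitVal_flipBits_some])
          (by rw [bitVal_xor, flipBits_none]; rfl),
        (hz _ hi).eq_zero_right, add_zero]
    · rw [message_flowCode_of_notMem _ _ _ hi, message_flowCode_of_notMem _ _ _ hi]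

/-- Protection of all cut vertices is enough for secure multicast of one bit. -/
theorem hasSecureMulticastRate_one {s : V} {D : Set V} (hD : ∀ d ∈ D, ∀ v, ¬ G.Adj d v)
    (hreach : ∀ d ∈ D, G.Reachable s d)
    (h : ∀ d ∈ D, ∀ u, G.IsCutVertex s d u → G.IsProtected s d u) :
    G.HasSecureMulticastRate s D (G.nodeEavesdroppers s D) 1 := by
  set j := bitIndex V none with hj
  have hcard : Fintype.card (({j} : Finset ℕ) → Bool) =
      Fintype.card (Fin ⌈(2 : ℝ) ^ (1 : ℝ)⌉₊) := by
    simp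
  let φ : (({j} : Finset ℕ) → Bool) ≃ Fin ⌈(2 : ℝ) ^ (1 : ℝ)⌉₊ := Fintype.equivOfCardEq hcard
  have hφ : ∀ ω : Outcome V, (φ fun k => ω s k) = φ fun _ => ω s j := by
    intro ω
    congr 1
    funext k
    rw [Finset.mem_singleton.1 k.2]
  have hKm : Measurable fun ω : Outcome V => φ fun k => ω s k := by
    simp_rw [hφ]
    exact (measurable_of_countable fun b : Bool => φ fun _ => b).comp
      ((measurable_pi_apply j).comp (measurable_pi_apply s))
  refine ⟨G.flowCode s D, {j}, φ, _, fun _ => rfl, ?_, ?_⟩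
  · intro d hd
    refine ⟨fun p => φ fun _ => decide (∑ c, G.inFlow d p.1 (Fintype.equivFin V d) c +
      (if s = d then bitVal (p.2 j) else 0) = 1), ?_, Filter.Eventually.of_forall fun ω => ?_⟩
    · exact measurable_of_finite_data (fun _ : Unit => j)
        fun (x : G.inEdges d → Fin (Fintype.card V) → ZMod 2) r => φ fun _ =>
          decide (∑ c, G.inFlow d x (Fintype.equivFin V d) c +
            (if s = d then bitVal (r ()) else 0) = 1)
    · refine Eq.trans (congrArg φ (funext fun _ => ?_)) (hφ ω).symm
      have hsum := (isRandomFlow_codeFlow s hd ω).sum_terminal (hreach d hd) (hD d hd)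
      rw [← decide_bitVal (ω s j), hj, ← hsum]
      congr 3
      by_cases hsd : s = d
      · subst hsd
        rfl
      · simp only [hsd, if_false]
  · rintro β ⟨u, hu, rfl⟩
    simp only [Set.mem_union, Set.mem_singleton_iff, not_or] at hu
    rw [mutualInfo_eq_zero_iff hKm ((G.flowCode s D).measurable_messagesOn _)]
    simp_rw [hφ]
    refine IndepFun.comp (φ := fun b : Bool => φ fun _ => b) (ψ := id) ?_
      (measurable_of_countable _) measurable_id
    refine indepFun_flowCode hD fun d hd => exists_isUnitFlow (hreach d hd) hu.2 ?_ (h d hd u)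
    rintro rfl
    exact hu.1 hd

end FlowCode

end AcyclicNetwork

end

theorem corollary1 {V : Type*} [Fintype V] (G : AcyclicNetwork V) (s : V) (D : Set V)
    (hD : ∀ d ∈ D, ∀ v, ¬ G.Adj d v)
    (hreach : ∀ d ∈ D, G.Reachable s d) :
    (∃ R : ℝ, 0 < R ∧ G.HasSecureMulticastRate s D (G.nodeEavesdroppers s D) R) ↔
      ∀ d ∈ D, ∀ u, G.IsCutVertex s d u → G.IsProtected s d u :=
  ⟨fun ⟨_, hR, h⟩ _ hd _ hcut =>
      AcyclicNetwork.isProtected_of_hasSecureMulticastRate hD hreach hR h hd hcut,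
    fun h => ⟨1, one_pos, AcyclicNetwork.hasSecureMulticastRate_one hD hreach h⟩⟩
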